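/- Let $H$ be a finite-dimensional complex Hilbert space, and let $S^{\bullet}(H^*)$ be the algebra of polynomials on $H$. For $k\ge 1$ give $H^{\otimes k}$ the induced inner product, and let $S^k(H)\subseteq H^{\otimes k}$ and $S^k(H^*)\subseteq (H^*)^{\otimes k}$ be the subspaces of tensors invariant under all permutations of the tensor factors; $S^k(H^*)$ is identified with the homogeneous polynomials of degree $k$ on $H$ by $\ell^{\otimes k}\mapsto \ell^k$. A density operator (state) is a positive semidefinite operator of trace one. Let $\mathrm{Tr}_{k-1}$ be the partial trace from operators on $H^{\otimes k}$ to operators on $H$ over $k-1$ copies of $H$ (on operators $\sigma\ge 0$ with image in $S^k(H)$ it does not matter which copies). Let $I\subseteq S^{\bullet}(H^*)$ be a homogeneous ideal, that is, an ideal generated by homogeneous polynomials, let $I_k = I\cap S^k(H^*)$ be its degree-$k$ component, and let $I_k^{\perp}\subseteq S^k(H)$ be the set of all $v\in S^k(H)$ that are annihilated by $I_k$ under the bilinear pairing $(\ell_1\otimes\cdots\otimes\ell_k,\ \psi_1\otimes\cdots\otimes\psi_k)=\prod_i \ell_i(\psi_i)$ of $(H^*)^{\otimes k}$ with $H^{\otimes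 k}$. Let $$X = V(I) = \{\psi\psi^* : \psi\in H,\ \|\psi\|=1,\ f(\psi)=0 \text{ for all } f\in I\},\qquad X^k=\mathrm{span}\{\psi^{\otimes k} : \psi\psi^*\in X\}\subseteq H^{\otimes k}.$$ A state $\rho$ on $H$ is called $X$-arable if it lies in the convex hull of $X$. **Theorem.** For every state $\rho$ on $H$ the following are equivalent: 1. $\rho$ is $X$-arable; 2. for every $k\ge 1$ there is a $(k,X)$-tension of $\rho$, that is, a density operator $\sigma_k$ on $H^{\otimes k}$ with $\mathrm{Im}(\sigma_k)\subseteq I_k^{\perp}$ and $\mathrm{Tr}_{k-1}(\sigma_k)=\rho$; 3. for every $k\ge 1$ there is a density operator $\sigma_k$ on $H^{\otimes k}$ with $\mathrm{Im}(\sigma_k)\subseteq X^k$ and $\mathrm{Tr}_{k-1}(\sigma_k)=\rho$. -/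

import Mathlib

open scoped TensorProduct

noncomputable section

namespace XTension

/-! ### Tensor powers of a Hilbert space -/

/-- The `k`-th tensor power of `H` as a Hilbert space. It is a copy of `⨂[ℂ]^k H`, so that it can
carry the Hilbert space structure with `⟪⊗ xᵢ, ⊗ yᵢ⟫ = ∏ ⟪xᵢ, yᵢ⟫`
(Mathlib puts a different norm on `⨂[ℂ]^k H` itself). -/
def TensorPow (H : Type*) [NormedAddCommGroup H] [InnerProductSpace ℂ H] (k : ℕ) : Type _ :=
  ⨂[ℂ]^k H

section TensorPow

variable {H : Type*} [NormedAddCommGroup H] [InnerProductSpace ℂ H] {k : ℕ}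

instance : AddCommGroup (TensorPow H k) := inferInstanceAs (AddCommGroup (⨂[ℂ]^k H))

instance : Module ℂ (TensorPow H k) := inferInstanceAs (Module ℂ (⨂[ℂ]^k H))

/-- The identity, as a linear equivalence between the Hilbert space `TensorPow H k` and the
underlying tensor power. -/
def TensorPow.toTensor (H : Type*) [NormedAddCommGroup H] [InnerProductSpace ℂ H] (k : ℕ) :
    TensorPow H k ≃ₗ[ℂ] ⨂[ℂ]^k H :=
  LinearEquiv.refl ℂ (⨂[ℂ]^k H)

/-- The product vector `x₁ ⊗ ⋯ ⊗ x_k`. -/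
def TensorPow.tprod (x : Fin k → H) : TensorPow H k :=
  (TensorPow.toTensor H k).symm (PiTensorProduct.tprod ℂ x)

variable [FiniteDimensional ℂ H]

/-- The product basis of `TensorPow H k` built from an orthonormal basis of `H`. -/
def TensorPow.basis (H : Type*) [NormedAddCommGroup H] [InnerProductSpace ℂ H]
    [FiniteDimensional ℂ H] (k : ℕ) :
    Module.Basis (Fin k → Fin (Module.finrank ℂ H)) ℂ (TensorPow H k) :=
  (Basis.piTensorProduct (fun _ : Fin k => (stdOrthonormalBasis ℂ H).toBasis)).map
    (TensorPow.toTensor H k).symm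

/-- The inner product on the tensor power, written in a product basis; `inner_tprod` below shows
that it is the usual one, and in particular does not depend on the basis. -/
@[reducible] def TensorPow.innerCore : InnerProductSpace.Core ℂ (TensorPow H k) where
  inner u v := ∑ w, (starRingEnd ℂ) ((TensorPow.basis H k).repr u w) * (TensorPow.basis H k).repr v w
  conj_inner_symm u v := by
    simp [mul_comm]
  re_inner_nonneg u := by
    have h (z : ℂ) : (starRingEnd ℂ) z * z = ((Complex.normSq z : ℝ) : ℂ) := by
      rw [mul_comm, Complex.mul_conj]
    simp only [h, ← Complex.ofReal_sum]
    exact Finset.sum_nonneg fun w _ => Complex.normSq_nonneg _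
  add_left u v w := by
    simp [add_mul, Finset.sum_add_distrib]
  smul_left u v r := by
    simp [Finset.mul_sum, mul_assoc]
  definite u hu := by
    have h (z : ℂ) : (starRingEnd ℂ) z * z = ((Complex.normSq z : ℝ) : ℂ) := by
      rw [mul_comm, Complex.mul_conj]
    simp only [h, ← Complex.ofReal_sum] at hu
    have hu' := Complex.ofReal_eq_zero.mp hu
    rw [Finset.sum_eq_zero_iff_of_nonneg fun w _ => Complex.normSq_nonneg _] at hu'
    refine (TensorPow.basis H k).ext_elem fun w => ?_
    simpa using hu' w (Finset.mem_univ w)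

instance : NormedAddCommGroup (TensorPow H k) :=
  TensorPow.innerCore.toNormedAddCommGroup

instance : InnerProductSpace ℂ (TensorPow H k) :=
  InnerProductSpace.ofCore TensorPow.innerCore.toCore

/-- The inner product on the tensor power is the one induced from `H`. -/
theorem TensorPow.inner_tprod (x y : Fin k → H) :
    inner ℂ (TensorPow.tprod x) (TensorPow.tprod y) = ∏ i, inner ℂ (x i) (y i) := by
  have h (x : Fin k → H) (w : Fin k → Fin (Module.finrank ℂ H)) :
      (TensorPow.basis H k).repr (TensorPow.tprod x) w
        = ∏ i, inner ℂ (stdOrthonormalBasis ℂ H (w i)) (x i) := by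
    simp [TensorPow.basis, TensorPow.tprod, Basis.piTensorProduct_repr_tprod_apply,
      OrthonormalBasis.repr_apply_apply]
  change ∑ w, (starRingEnd ℂ) ((TensorPow.basis H k).repr (TensorPow.tprod x) w)
    * (TensorPow.basis H k).repr (TensorPow.tprod y) w = _
  simp only [h, map_prod, inner_conj_symm, ← Finset.prod_mul_distrib]
  rw [← Fintype.prod_sum (fun i j => inner ℂ (x i) (stdOrthonormalBasis ℂ H j)
    * inner ℂ (stdOrthonormalBasis ℂ H j) (y i))]
  exact Finset.prod_congr rfl fun i _ => OrthonormalBasis.sum_inner_mul_inner _ _ _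

end TensorPow

/-! ### States -/

/-- Density operators (states) on a Hilbert space: positive semidefinite operators of trace one. -/
def IsDensity {J : Type*} [NormedAddCommGroup J] [InnerProductSpace ℂ J] (ρ : J →ₗ[ℂ] J) : Prop :=
  ρ.IsPositive ∧ LinearMap.trace ℂ J ρ = 1

/-- The operator `ψψ*`, that is `φ ↦ ⟪ψ, φ⟫ ψ`. -/
def ketbra {H : Type*} [NormedAddCommGroup H] [InnerProductSpace ℂ H] (ψ : H) : H →ₗ[ℂ] H :=
  (InnerProductSpace.rankOne ℂ ψ ψ : H →L[ℂ] H)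

/-- `H^{⊗(k+1)} = H^{⊗k} ⊗ H`. -/
def splitLast (H : Type*) [NormedAddCommGroup H] [InnerProductSpace ℂ H] (k : ℕ) :
    (⨂[ℂ]^k H) ⊗[ℂ] H ≃ₗ[ℂ] TensorPow H (k + 1) :=
  (LinearEquiv.lTensor (⨂[ℂ]^k H)
      (PiTensorProduct.subsingletonEquiv (R := ℂ) (s := fun _ : Fin 1 => H) 0).symm).trans
    ((TensorPower.mulEquiv (R := ℂ) (M := H) (n := k) (m := 1)).trans
      (TensorPow.toTensor H (k + 1)).symm)

/-- The partial trace `Tr_k : End(H^{⊗(k+1)}) → End(H)` over `k` of the `k+1` copies of `H` (all but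
the last): under `End(H^{⊗k} ⊗ H) = End(H^{⊗k}) ⊗ End(H)`, it is the linear map
`A ⊗ B ↦ Tr(A) B`. -/
def partialTrace (H : Type*) [NormedAddCommGroup H] [InnerProductSpace ℂ H]
    [FiniteDimensional ℂ H] (k : ℕ) :
    Module.End ℂ (TensorPow H (k + 1)) →ₗ[ℂ] Module.End ℂ H :=
  (TensorProduct.lid ℂ (Module.End ℂ H)).toLinearMap
    ∘ₗ TensorProduct.map (LinearMap.trace ℂ (⨂[ℂ]^k H)) LinearMap.id
    ∘ₗ (homTensorHomEquiv ℂ (⨂[ℂ]^k H) H (⨂[ℂ]^k H) H).symm.toLinearMap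
    ∘ₗ ((splitLast H k).symm.conj).toLinearMap

/-! ### Polynomials and ideals -/

/-- The algebra `S^•(H^*)` of polynomials on `H`. -/
abbrev PolyRing (H : Type*) [NormedAddCommGroup H] [InnerProductSpace ℂ H] : Type _ :=
  SymmetricAlgebra ℂ (Module.Dual ℂ H)

/-- The value `f(ψ)` of a polynomial `f` at `ψ`, as an algebra homomorphism in `f`. -/
def evalAt {H : Type*} [NormedAddCommGroup H] [InnerProductSpace ℂ H] (ψ : H) : PolyRing H →ₐ[ℂ] ℂ :=
  SymmetricAlgebra.lift (Module.Dual.eval ℂ H ψ)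

/-- The symmetric subspace `S^k(V)` of `V^{⊗k}`: the tensors that are fixed by all permutations
of the tensor factors. -/
def symSubspace (V : Type*) [AddCommGroup V] [Module ℂ V] (k : ℕ) : Submodule ℂ (⨂[ℂ]^k V) :=
  ⨅ π : Equiv.Perm (Fin k),
    LinearMap.eqLocus (PiTensorProduct.reindex ℂ (fun _ : Fin k => V) π).toLinearMap LinearMap.id

/-- The linear map `(H^*)^{⊗k} → S^•(H^*)` with `ℓ₁ ⊗ ⋯ ⊗ ℓ_k ↦ ℓ₁ ⋯ ℓ_k`. On symmetric tensors
it is the identification of `S^k(H^*) ⊆ (H^*)^{⊗k}` with the homogeneous polynomials of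
degree `k`. -/
def tensorToPoly (H : Type*) [NormedAddCommGroup H] [InnerProductSpace ℂ H] (k : ℕ) :
    (⨂[ℂ]^k (Module.Dual ℂ H)) →ₗ[ℂ] PolyRing H :=
  PiTensorProduct.lift ((MultilinearMap.mkPiAlgebra ℂ (Fin k) (PolyRing H)).compLinearMap
    fun _ => SymmetricAlgebra.ι ℂ (Module.Dual ℂ H))

/-- The homogeneous polynomials of degree `k` on `H`. -/
def homogeneousPoly (H : Type*) [NormedAddCommGroup H] [InnerProductSpace ℂ H] (k : ℕ) :
    Submodule ℂ (PolyRing H) :=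
  LinearMap.range (tensorToPoly H k)

/-- An ideal of polynomials is homogeneous if it is generated by homogeneous polynomials. -/
def IsHomogeneousIdeal {H : Type*} [NormedAddCommGroup H] [InnerProductSpace ℂ H]
    (I : Ideal (PolyRing H)) : Prop :=
  ∃ S : Set (PolyRing H), (∀ f ∈ S, ∃ d, f ∈ homogeneousPoly H d) ∧ I = Ideal.span S

/-- The degree-`k` component `I_k` of `I`, as a subspace of `S^k(H^*) ⊆ (H^*)^{⊗k}`. -/
def idealComponent {H : Type*} [NormedAddCommGroup H] [InnerProductSpace ℂ H]
    (I : Ideal (PolyRing H)) (k : ℕ) : Submodule ℂ (⨂[ℂ]^k (Module.Dual ℂ H)) :=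
  symSubspace (Module.Dual ℂ H) k ⊓ (I.restrictScalars ℂ).comap (tensorToPoly H k)

/-- `I_k^⊥ ⊆ S^k(H) ⊆ H^{⊗k}`: the symmetric tensors annihilated by `I_k` under the bilinear
pairing `(ℓ₁ ⊗ ⋯ ⊗ ℓ_k, ψ₁ ⊗ ⋯ ⊗ ψ_k) = ∏ ℓᵢ(ψᵢ)` between `(H^*)^{⊗k}` and `H^{⊗k}`. -/
def perp {H : Type*} [NormedAddCommGroup H] [InnerProductSpace ℂ H]
    (I : Ideal (PolyRing H)) (k : ℕ) : Submodule ℂ (TensorPow H k) :=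
  (symSubspace H k ⊓ ⨅ f ∈ idealComponent I k,
    LinearMap.ker (PiTensorProduct.dualDistrib (M := fun _ : Fin k => H) f)).comap
      (TensorPow.toTensor H k).toLinearMap

/-! ### `X`-arability and tensions -/

/-- The projective variety `V(I)`: the set of pure states `ψψ*`, `‖ψ‖ = 1`, for which all
polynomials in `I` vanish at `ψ`. -/
def variety {H : Type*} [NormedAddCommGroup H] [InnerProductSpace ℂ H]
    (I : Ideal (PolyRing H)) : Set (H →ₗ[ℂ] H) :=
  {P | ∃ ψ : H, ‖ψ‖ = 1 ∧ (∀ f ∈ I, evalAt ψ f = 0) ∧ P = ketbra ψ}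

/-- A state is `X`-arable if it lies in the convex hull of the set `X` of pure states. -/
def IsArable {H : Type*} [NormedAddCommGroup H] [InnerProductSpace ℂ H]
    (X : Set (H →ₗ[ℂ] H)) (ρ : H →ₗ[ℂ] H) : Prop :=
  ρ ∈ convexHull ℝ X

/-- `σ` is a state on `k+1` copies of `H` with image in the subspace `W`, and its partial trace over
`k` copies is `ρ`. -/
def IsTension {H : Type*} [NormedAddCommGroup H] [InnerProductSpace ℂ H] [FiniteDimensional ℂ H]
    {k : ℕ} (W : Submodule ℂ (TensorPow H (k + 1))) (ρ : H →ₗ[ℂ] H)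
    (σ : TensorPow H (k + 1) →ₗ[ℂ] TensorPow H (k + 1)) : Prop :=
  IsDensity σ ∧ LinearMap.range σ ≤ W ∧ partialTrace H k σ = ρ

/-- The span `X^k ⊆ H^{⊗k}` of the vectors `ψ^{⊗k}` with `ψψ* ∈ X`. -/
def powerSpan {H : Type*} [NormedAddCommGroup H] [InnerProductSpace ℂ H]
    (X : Set (H →ₗ[ℂ] H)) (k : ℕ) : Submodule ℂ (TensorPow H k) :=
  Submodule.span ℂ {v | ∃ ψ : H, ketbra ψ ∈ X ∧ v = TensorPow.tprod fun _ => ψ}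

end XTension

end

/-! The implication from 1 to 3 is a convexity argument: a mixture of the states `ψψ*` lifts to the
same mixture of the projections onto `ψ^{⊗k}`. From 3 to 2 holds because `X^k ⊆ I_k^⊥`
(`powerSpan_le_perp`). The substance is 2 to 1, a quantum de Finetti theorem without error bounds,
obtained from compactness and Krein–Milman.

In an orthonormal basis, the tensions of `ρ` for all `k` are condensed by compactness into one
infinite family `τ 0, τ 1, ...` of states. Each member is the marginal of the next, the range of
each is annihilated by the tensors representing elements of `I`, and the one-particle member is `ρ`
(`mem_convexHull_zeroProjections`). Such families form a compact convex set.

Let `τ` be an extreme point and `0 ≤ A ≤ 1`. Measuring `A` and `1 - A` on the first factor splits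
`τ` into two unnormalised families of the same kind: the range condition survives because `I` is an
ideal, and consistency survives because the range is symmetric. Extremality makes both parts
proportional to `τ`, so `τ j` is a product `R^{⊗j}` (`apply_eq_prod_of_extreme`). Symmetry of `R ⊗
R` under exchanging row indices only forces `R = ψψ*`, and the range condition then says that
homogeneous elements of `I` vanish at `ψ`. The one-particle marginal is linear and continuous, and
the convex hull of the projections is compact, so Krein–Milman carries the conclusion from extreme
points to all families (`singleMarginal_mem_convexHull`). -/

noncomputable section

namespace XTension

/-! ### Consistent families of states in coordinates: slicing and compactness -/

section Coordinates

open scoped ComplexOrder Matrix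

variable {ι : Type*} [Fintype ι]

/-- Sequences of operators on the tensor powers of `ℂ^ι`, as matrices in the product basis. -/
abbrev MatrixFamily (ι : Type*) : Type _ := ∀ j : ℕ, Matrix (Fin j → ι) (Fin j → ι) ℂ

theorem sum_fin_succ_fun {M : Type*} [AddCommMonoid M] {j : ℕ} (f : (Fin (j + 1) → ι) → M) :
    ∑ w, f w = ∑ i, ∑ a : Fin j → ι, f (Fin.cons i a) := by
  rw [← (Fin.consEquiv fun _ : Fin (j + 1) => ι).sum_comp, Fintype.sum_prod_type]
  rfl

/-- `u` vanishes on the range of `M`. -/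
def Annihilates {m n : Type*} [Fintype m] (N : Set (m → ℂ)) (M : Matrix m n ℂ) : Prop :=
  ∀ u ∈ N, ∀ b, ∑ a, u a * M a b = 0

/-- The `j`-th member of `τ` is positive, its range is annihilated by `N j`, and it is the marginal
of the next member. -/
structure CompatibleAt (N : ∀ j : ℕ, Set ((Fin j → ι) → ℂ)) (τ : MatrixFamily ι) (j : ℕ) :
    Prop where
  posSemidef : (τ j).PosSemidef
  annihilates : Annihilates (N j) (τ j)
  marginal : ∀ a b, ∑ i, τ (j + 1) (Fin.cons i a) (Fin.cons i b) = τ j a b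

/-- The conditions on `N` used below: stability under tensoring with basis vectors from the left,
and presence of the differences that enforce symmetry in the first two factors. -/
structure IsSymmetricIdealFamily [DecidableEq ι] (N : ∀ j : ℕ, Set ((Fin j → ι) → ℂ)) : Prop where
  cons_mem : ∀ j, ∀ u ∈ N j, ∀ i : ι,
    (fun w : Fin (j + 1) → ι => if w 0 = i then u (Fin.tail w) else 0) ∈ N (j + 1)
  swap_mem : ∀ j (a : Fin j → ι) (i k : ι),
    (Pi.single (Fin.cons i (Fin.cons k a)) 1 - Pi.single (Fin.cons k (Fin.cons i a)) 1 :
      (Fin (j + 2) → ι) → ℂ) ∈ N (j + 2)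

/-- The matrix `Tr₁((A ⊗ 1) M)` (up to transposition of `A`). -/
def slice {j : ℕ} (A : Matrix ι ι ℂ) (M : Matrix (Fin (j + 1) → ι) (Fin (j + 1) → ι) ℂ) :
    Matrix (Fin j → ι) (Fin j → ι) ℂ :=
  Matrix.of fun a b => ∑ i, ∑ l, A i l * M (Fin.cons i a) (Fin.cons l b)

theorem slice_apply {j : ℕ} (A : Matrix ι ι ℂ)
    (M : Matrix (Fin (j + 1) → ι) (Fin (j + 1) → ι) ℂ) (a b : Fin j → ι) :
    slice A M a b = ∑ i, ∑ l, A i l * M (Fin.cons i a) (Fin.cons l b) := rfl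

theorem slice_one [DecidableEq ι] {j : ℕ} (M : Matrix (Fin (j + 1) → ι) (Fin (j + 1) → ι) ℂ) (a b : Fin j → ι) :
    slice 1 M a b = ∑ i, M (Fin.cons i a) (Fin.cons i b) := by
  simp [slice_apply, Matrix.one_apply]

theorem slice_add {j : ℕ} (A B : Matrix ι ι ℂ)
    (M : Matrix (Fin (j + 1) → ι) (Fin (j + 1) → ι) ℂ) :
    slice (A + B) M = slice A M + slice B M := by
  ext a b
  simp [slice_apply, add_mul, Finset.sum_add_distrib]

theorem trace_slice_one [DecidableEq ι] {j : ℕ} (M : Matrix (Fin (j + 1) → ι) (Fin (j + 1) → ι) ℂ) :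
    (slice 1 M).trace = M.trace := by
  simp only [Matrix.trace, Matrix.diag_apply, slice_one, sum_fin_succ_fun (fun w => M w w)]
  exact Finset.sum_comm

open scoped MatrixOrder Matrix.Norms.L2Operator in
-- Factoring `A = Bᴴ * B` puts the slice in Kraus form `∑ (C m)ᴴ * M * C m`, where `C m` is the
-- `m`-th row of `B` tensored with the identity.
theorem posSemidef_slice [DecidableEq ι] {j : ℕ} {A : Matrix ι ι ℂ}
    {M : Matrix (Fin (j + 1) → ι) (Fin (j + 1) → ι) ℂ} (hA : A.PosSemidef) (hM : M.PosSemidef) :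
    (slice A M).PosSemidef := by
  obtain ⟨B, rfl⟩ : ∃ B : Matrix ι ι ℂ, A = Bᴴ * B :=
    CStarAlgebra.nonneg_iff_eq_star_mul_self.mp hA.nonneg
  let C (m : ι) : Matrix (Fin (j + 1) → ι) (Fin j → ι) ℂ :=
    Matrix.of fun w a => if Fin.tail w = a then B m (w 0) else 0
  have h : slice (Bᴴ * B) M = ∑ m, (C m)ᴴ * M * C m := by
    ext a b
    simp only [slice_apply, Matrix.sum_apply, Matrix.mul_apply, Matrix.conjTranspose_apply,
      sum_fin_succ_fun, C, Matrix.of_apply, Fin.tail_cons, Fin.cons_zero, apply_ite star, star_zero,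
      ite_mul, mul_ite, zero_mul, mul_zero, Finset.sum_ite_eq', Finset.mem_univ, if_true,
      Finset.sum_mul]
    rw [Finset.sum_congr rfl fun i _ => Finset.sum_comm, Finset.sum_comm]
    refine Finset.sum_congr rfl fun m _ => ?_
    rw [Finset.sum_comm]
    refine Finset.sum_congr rfl fun l _ => Finset.sum_congr rfl fun i _ => ?_
    ring
  rw [h]
  exact Matrix.posSemidef_sum _ fun m _ => hM.conjTranspose_mul_mul_same _

variable {N : ∀ j : ℕ, Set ((Fin j → ι) → ℂ)}

theorem annihilates_slice [DecidableEq ι] (hN : IsSymmetricIdealFamily N) {j : ℕ} (A : Matrix ι ι ℂ)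
    {M : Matrix (Fin (j + 1) → ι) (Fin (j + 1) → ι) ℂ} (hM : Annihilates (N (j + 1)) M) :
    Annihilates (N j) (slice A M) := by
  intro u hu b
  have h (i l : ι) : ∑ a, u a * M (Fin.cons i a) (Fin.cons l b) = 0 := by
    -- Tensoring `u` with the `i`-th basis vector, which is multiplication by a coordinate, isolates
    -- a single block of `M`.
    have := hM _ (hN.cons_mem j u hu i) (Fin.cons l b)
    simpa [sum_fin_succ_fun, ite_mul, Finset.sum_ite_irrel] using this
  simp only [slice_apply, Finset.mul_sum]
  rw [Finset.sum_comm]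
  refine Finset.sum_eq_zero fun i _ => ?_
  rw [Finset.sum_comm]
  refine Finset.sum_eq_zero fun l _ => ?_
  simp only [mul_left_comm (u _)]
  rw [← Finset.mul_sum, h, mul_zero]

theorem apply_cons_cons_comm [DecidableEq ι] (hN : IsSymmetricIdealFamily N) {j : ℕ}
    {M : Matrix (Fin (j + 2) → ι) (Fin (j + 2) → ι) ℂ} (hM : Annihilates (N (j + 2)) M)
    (i k : ι) (a : Fin j → ι) (b : Fin (j + 2) → ι) :
    M (Fin.cons i (Fin.cons k a)) b = M (Fin.cons k (Fin.cons i a)) b := by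
  have := hM _ (hN.swap_mem j a i k) b
  simpa [sub_mul, Finset.sum_sub_distrib, Pi.single_apply, sub_eq_zero] using this

theorem apply_cons_cons_comm' [DecidableEq ι] (hN : IsSymmetricIdealFamily N) {j : ℕ}
    {M : Matrix (Fin (j + 2) → ι) (Fin (j + 2) → ι) ℂ} (hM : Annihilates (N (j + 2)) M)
    (hM' : M.IsHermitian)
    (i k : ι) (a : Fin j → ι) (b : Fin (j + 2) → ι) :
    M b (Fin.cons i (Fin.cons k a)) = M b (Fin.cons k (Fin.cons i a)) := by
  rw [← hM'.apply b, ← hM'.apply b, apply_cons_cons_comm hN hM]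

/-- Slicing and the marginal both act on the first factor. Exchanging the first two factors, in rows
and in columns, lets the marginal be taken before the slice. -/
theorem compatibleAt_slice [DecidableEq ι] (hN : IsSymmetricIdealFamily N) {τ : MatrixFamily ι}
    (hτ : ∀ j, CompatibleAt N τ j) {A : Matrix ι ι ℂ} (hA : A.PosSemidef) (j : ℕ) :
    CompatibleAt N (fun j => slice A (τ (j + 1))) j where
  posSemidef := posSemidef_slice hA (hτ _).posSemidef
  annihilates := annihilates_slice hN A (hτ _).annihilates
  marginal a b := by
    simp only [slice_apply]
    rw [Finset.sum_comm]
    refine Finset.sum_congr rfl fun i _ => ?_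
    rw [Finset.sum_comm]
    refine Finset.sum_congr rfl fun l _ => ?_
    rw [← Finset.mul_sum, ← (hτ (j + 1)).marginal]
    congr 1
    refine Finset.sum_congr rfl fun k _ => ?_
    rw [apply_cons_cons_comm hN (hτ _).annihilates,
      apply_cons_cons_comm' hN (hτ _).annihilates (hτ _).posSemidef.isHermitian]

theorem trace_eq_trace_zero [DecidableEq ι] {τ : MatrixFamily ι} {j : ℕ} (hτ : ∀ i < j, CompatibleAt N τ i) :
    (τ j).trace = (τ 0).trace := by
  induction j with
  | zero => rfl
  | succ j ih =>
    rw [← ih fun i hi => hτ i (hi.trans j.lt_succ_self), ← trace_slice_one]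
    congr 1
    ext a b
    rw [slice_one, (hτ j j.lt_succ_self).marginal]

theorem norm_apply_le_of_posSemidef {m : Type*} [Fintype m] [DecidableEq m] {M : Matrix m m ℂ}
    (hM : M.PosSemidef) (htr : M.trace = 1) (a b : m) : ‖M a b‖ ≤ 1 := by
  have hd (c : m) : 0 ≤ M c c := hM.diag_nonneg
  have hd1 (c : m) : M c c ≤ 1 := by
    rw [← htr]
    exact Finset.single_le_sum (f := fun c => M c c) (fun c _ => hd c) (Finset.mem_univ c)
  -- The principal minor on `a, b` gives `|M a b|² ≤ M a a * M b b`, and the diagonal entries are at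
  -- most the trace.
  have hdet := (hM.submatrix ![a, b]).det_nonneg
  rw [Matrix.det_fin_two] at hdet
  simp only [Matrix.submatrix_apply, Matrix.cons_val_zero, Matrix.cons_val_one] at hdet
  rw [← hM.isHermitian.apply b a, Complex.star_def, Complex.mul_conj, sub_nonneg] at hdet
  have h1 : ((Complex.normSq (M a b) : ℝ) : ℂ) ≤ ((1 : ℝ) : ℂ) := by
    refine hdet.trans ((mul_le_mul (hd1 a) (hd1 b) (hd b) zero_le_one).trans ?_)
    simp
  rw [Complex.real_le_real, Complex.normSq_eq_norm_sq] at h1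
  exact (sq_le_one_iff₀ (norm_nonneg _)).mp h1

theorem eq_zero_of_compatibleAt [DecidableEq ι] {τ : MatrixFamily ι} (hτ : ∀ j, CompatibleAt N τ j)
    (h0 : (τ 0).trace = 0) : τ = 0 := by
  funext j
  exact (hτ j).posSemidef.trace_eq_zero_iff.mp
    ((trace_eq_trace_zero fun i _ => hτ i).trans h0)

theorem CompatibleAt.add {τ τ' : MatrixFamily ι} {j : ℕ} (h : CompatibleAt N τ j)
    (h' : CompatibleAt N τ' j) : CompatibleAt N (τ + τ') j where
  posSemidef := h.posSemidef.add h'.posSemidef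
  annihilates u hu b := by
    simp [mul_add, Finset.sum_add_distrib, h.annihilates u hu, h'.annihilates u hu]
  marginal a b := by
    simp [Finset.sum_add_distrib, h.marginal, h'.marginal]

theorem CompatibleAt.smul {τ : MatrixFamily ι} {j : ℕ} (h : CompatibleAt N τ j) {c : ℝ}
    (hc : 0 ≤ c) : CompatibleAt N (c • τ) j where
  posSemidef := by
    have := h.posSemidef.smul (a := (c : ℂ)) (by exact_mod_cast hc)
    simpa using this
  annihilates u hu b := by
    have := h.annihilates u hu b
    simp [mul_left_comm (u _), ← Finset.mul_sum, this]
  marginal a b := by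
    simp [← Finset.mul_sum, h.marginal]

/-- The consistent sequences of states. -/
def compatibleFamilies (N : ∀ j : ℕ, Set ((Fin j → ι) → ℂ)) : Set (MatrixFamily ι) :=
  {τ | (∀ j, CompatibleAt N τ j) ∧ (τ 0).trace = 1}

theorem convex_compatibleFamilies : Convex ℝ (compatibleFamilies N) := by
  rintro τ ⟨h, h1⟩ τ' ⟨h', h1'⟩ p q hp hq hpq
  refine ⟨fun j => ((h j).smul hp).add ((h' j).smul hq), ?_⟩
  have : ((p : ℂ) + q) = 1 := by exact_mod_cast hpq
  simpa [Matrix.trace_add, Matrix.trace_smul, h1, h1'] using this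

theorem isClosed_compatibleAt (j : ℕ) : IsClosed {τ : MatrixFamily ι | CompatibleAt N τ j} := by
  have e (k : ℕ) (a b : Fin k → ι) : Continuous fun τ : MatrixFamily ι => τ k a b := by
    fun_prop
  have : {τ : MatrixFamily ι | CompatibleAt N τ j} =
      {τ | (τ j)ᴴ = τ j} ∩ {τ | ∀ x, 0 ≤ star x ⬝ᵥ (τ j *ᵥ x)}
        ∩ {τ | ∀ u ∈ N j, ∀ b, ∑ a, u a * τ j a b = 0}
        ∩ {τ | ∀ a b, ∑ i, τ (j + 1) (Fin.cons i a) (Fin.cons i b) = τ j a b} := by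
    ext τ
    simp only [Set.mem_inter_iff, Set.mem_ofPred_eq]
    exact ⟨fun h => ⟨⟨Matrix.posSemidef_iff_dotProduct_mulVec.mp h.1, h.2⟩, h.3⟩,
      fun h => ⟨Matrix.posSemidef_iff_dotProduct_mulVec.mpr h.1.1, h.1.2, h.2⟩⟩
  rw [this]
  refine ((IsClosed.inter ?_ ?_).inter ?_).inter ?_
  · exact isClosed_eq (by fun_prop) (by fun_prop)
  · simp only [Set.ofPred_forall]
    exact isClosed_iInter fun x => isClosed_le (by fun_prop) (by fun_prop)
  · simp only [Set.ofPred_forall]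
    exact isClosed_iInter fun u => isClosed_iInter fun _ => isClosed_iInter fun b =>
      isClosed_eq (by fun_prop) (by fun_prop)
  · simp only [Set.ofPred_forall]
    exact isClosed_iInter fun a => isClosed_iInter fun b => isClosed_eq (by fun_prop) (by fun_prop)

theorem isCompact_norm_apply_le_one (ι : Type*) :
    IsCompact {τ : MatrixFamily ι | ∀ j a b, ‖τ j a b‖ ≤ 1} := by
  have : {τ : MatrixFamily ι | ∀ j a b, ‖τ j a b‖ ≤ 1} =
      Set.pi Set.univ fun j => Set.pi Set.univ fun a => Set.pi Set.univ fun b =>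
        Metric.closedBall (0 : ℂ) 1 := by
    ext τ
    exact ⟨fun h j _ a _ b _ => mem_closedBall_zero_iff.mpr (h j a b),
      fun h j a b => mem_closedBall_zero_iff.mp (h j trivial a trivial b trivial)⟩
  rw [this]
  exact isCompact_univ_pi fun j => isCompact_univ_pi fun a => isCompact_univ_pi fun b =>
    isCompact_closedBall _ _

/-- All entries of a state lie in the unit disc, so the set is closed in a product of discs, which
is compact by Tychonoff. -/
theorem isCompact_compatibleFamilies [DecidableEq ι] : IsCompact (compatibleFamilies N) := by
  refine (isCompact_norm_apply_le_one ι).of_isClosed_subset ?_ ?_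
  · have : compatibleFamilies N =
        (⋂ j, {τ | CompatibleAt N τ j}) ∩ {τ : MatrixFamily ι | (τ 0).trace = 1} := by
      ext τ
      simp [compatibleFamilies]
    rw [this]
    exact (isClosed_iInter isClosed_compatibleAt).inter
      (isClosed_eq (by fun_prop) continuous_const)
  · rintro τ ⟨h, h1⟩ j a b
    exact norm_apply_le_of_posSemidef (h j).posSemidef
      ((trace_eq_trace_zero fun i _ => h i).trans h1) a b

end Coordinates

/-- By Carathéodory, combinations of at most `finrank ℝ E + 1` points suffice, so the hull is a
finite union of continuous images of a simplex times a power of `s`. -/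
theorem isCompact_convexHull_of_isCompact {E : Type*} [AddCommGroup E] [Module ℝ E]
    [FiniteDimensional ℝ E] [TopologicalSpace E] [ContinuousAdd E] [ContinuousSMul ℝ E]
    {s : Set E} (hs : IsCompact s) : IsCompact (convexHull ℝ s) := by
  let Φ (n : ℕ) (p : (Fin n → ℝ) × (Fin n → E)) : E := ∑ i, p.1 i • p.2 i
  have h : convexHull ℝ s = ⋃ n ∈ Set.Iic (Module.finrank ℝ E + 1),
      Φ n '' (stdSimplex ℝ (Fin n) ×ˢ Set.pi Set.univ fun _ => s) := by
    refine subset_antisymm (fun x hx => ?_) ?_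
    · obtain ⟨κ, _, z, w, hz, hind, hw, hw1, rfl⟩ := eq_pos_convex_span_of_mem_convexHull hx
      let e := Fintype.equivFin κ
      refine Set.mem_biUnion (x := Fintype.card κ) ?_ ⟨(w ∘ e.symm, z ∘ e.symm), ⟨⟨?_, ?_⟩, ?_⟩, ?_⟩
      · exact hind.card_le_finrank_succ.trans
          (Nat.add_le_add_right (Submodule.finrank_le _) 1)
      · exact fun i => (hw _).le
      · exact (e.symm.sum_comp w).trans hw1
      · exact fun i _ => hz ⟨_, rfl⟩
      · exact e.symm.sum_comp fun i => w i • z i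
    · simp only [Set.iUnion_subset_iff, Set.image_subset_iff]
      rintro n - ⟨w, z⟩ ⟨⟨hw, hw1⟩, hz⟩
      exact (convex_convexHull ℝ s).sum_mem (fun i _ => hw i) hw1
        fun i _ => subset_convexHull ℝ s (hz i trivial)
  rw [h]
  refine (Set.finite_Iic _).isCompact_biUnion fun n _ => ?_
  exact ((isCompact_stdSimplex ℝ (Fin n)).prod (isCompact_univ_pi fun _ => hs)).image
    (by fun_prop)

/-! ### Extreme families are powers of a pure state; Krein–Milman -/

section ExtremePoints

open scoped ComplexOrder Matrix

variable {ι : Type*} [Fintype ι] {N : ∀ j : ℕ, Set ((Fin j → ι) → ℂ)}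

theorem slice_smul {j : ℕ} (c : ℂ) (A : Matrix ι ι ℂ)
    (M : Matrix (Fin (j + 1) → ι) (Fin (j + 1) → ι) ℂ) :
    slice (c • A) M = c • slice A M := by
  ext a b
  simp [slice_apply, Finset.mul_sum, mul_assoc]

theorem slice_single [DecidableEq ι] {j : ℕ} (i l : ι)
    (M : Matrix (Fin (j + 1) → ι) (Fin (j + 1) → ι) ℂ) (a b : Fin j → ι) :
    slice (Matrix.single i l 1) M a b = M (Fin.cons i a) (Fin.cons l b) := by
  rw [slice_apply, Finset.sum_eq_single i, Finset.sum_eq_single l]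
  · simp
  · intro k _ hk
    simp [hk.symm]
  · simp
  · intro k _ hk
    simp [hk.symm]
  · simp

theorem inv_smul_mem_compatibleFamilies {τ : MatrixFamily ι} (hτ : ∀ j, CompatibleAt N τ j) {p : ℝ}
    (hp : 0 < p) (h : (τ 0).trace = p) : p⁻¹ • τ ∈ compatibleFamilies N := by
  refine ⟨fun j => (hτ j).smul (inv_nonneg.mpr hp.le), ?_⟩
  have : (p : ℂ) ≠ 0 := by exact_mod_cast hp.ne'
  simp [Matrix.trace_smul, h, this]

/-- The slices by `A` and `1 - A` are compatible families with sum `τ`. When both traces are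
positive, normalising them exhibits `τ` as a proper convex combination, so extremality applies; a
part of trace zero vanishes altogether. -/
theorem slice_eq_smul_of_le_one [DecidableEq ι] (hN : IsSymmetricIdealFamily N)
    {τ : MatrixFamily ι} (hτ : τ ∈ (compatibleFamilies N).extremePoints ℝ) {A : Matrix ι ι ℂ}
    (hA : A.PosSemidef) (hA' : (1 - A).PosSemidef) (j : ℕ) :
    slice A (τ (j + 1)) = (slice A (τ 1)).trace • τ j := by
  obtain ⟨⟨hc, h1⟩, hext⟩ := mem_extremePoints_iff_left.mp hτ
  set σ : MatrixFamily ι := fun j => slice A (τ (j + 1)) with hσ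
  set σ' : MatrixFamily ι := fun j => slice (1 - A) (τ (j + 1)) with hσ'
  have hcσ : ∀ j, CompatibleAt N σ j := compatibleAt_slice hN hc hA
  have hcσ' : ∀ j, CompatibleAt N σ' j := compatibleAt_slice hN hc hA'
  have hsum : σ + σ' = τ := by
    funext j
    change slice A (τ (j + 1)) + slice (1 - A) (τ (j + 1)) = τ j
    rw [← slice_add, add_sub_cancel]
    ext a b
    rw [slice_one, (hc j).marginal]
  change σ j = (σ 0).trace • τ j
  obtain ⟨p, hp, hpσ⟩ : ∃ p : ℝ, 0 ≤ p ∧ (σ 0).trace = p :=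
    ⟨_, (Complex.nonneg_iff.mp (hcσ 0).posSemidef.trace_nonneg).1,
      Complex.eq_re_of_ofReal_le (r := 0) (by simpa using (hcσ 0).posSemidef.trace_nonneg)⟩
  obtain ⟨q, hq, hqσ⟩ : ∃ q : ℝ, 0 ≤ q ∧ (σ' 0).trace = q :=
    ⟨_, (Complex.nonneg_iff.mp (hcσ' 0).posSemidef.trace_nonneg).1,
      Complex.eq_re_of_ofReal_le (r := 0) (by simpa using (hcσ' 0).posSemidef.trace_nonneg)⟩
  have hpq : p + q = 1 := by
    have : (σ 0).trace + (σ' 0).trace = 1 := by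
      rw [← Matrix.trace_add, ← h1, ← hsum]
      rfl
    rw [hpσ, hqσ] at this
    exact_mod_cast this
  rcases hp.eq_or_lt with rfl | hp
  · rw [eq_zero_of_compatibleAt hcσ (by simpa using hpσ)]
    simp
  rcases hq.eq_or_lt with rfl | hq
  · rw [eq_zero_of_compatibleAt hcσ' (by simpa using hqσ), add_zero] at hsum
    rw [hsum, h1, one_smul]
  · have := hext _ (inv_smul_mem_compatibleFamilies hcσ hp hpσ)
      _ (inv_smul_mem_compatibleFamilies hcσ' hq hqσ)
      ⟨p, q, hp, hq, hpq, by rw [smul_inv_smul₀ hp.ne', smul_inv_smul₀ hq.ne', hsum]⟩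
    rw [inv_smul_eq_iff₀ hp.ne'] at this
    rw [hpσ, this]
    simp

open scoped MatrixOrder Matrix.Norms.L2Operator in
-- Both sides are linear in `A`, and the positive matrices span; each of them can be rescaled to lie
-- between `0` and `1`.
theorem slice_eq_smul_of_extreme [DecidableEq ι] (hN : IsSymmetricIdealFamily N)
    {τ : MatrixFamily ι} (hτ : τ ∈ (compatibleFamilies N).extremePoints ℝ) (A : Matrix ι ι ℂ)
    (j : ℕ) : slice A (τ (j + 1)) = (slice A (τ 1)).trace • τ j := by
  have hmem : A ∈ Submodule.span ℂ {B : Matrix ι ι ℂ | 0 ≤ B} := by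
    rw [CStarAlgebra.span_nonneg]
    trivial
  induction hmem using Submodule.span_induction with
  | mem B hB =>
    -- The added `1` keeps the scaling factor invertible when `B = 0`.
    have hc : (0 : ℝ) < ‖B‖ + 1 := by positivity
    have hc' : ((‖B‖ + 1 : ℝ) : ℂ) ≠ 0 := by exact_mod_cast hc.ne'
    have hB' : (((‖B‖ + 1 : ℝ) : ℂ)⁻¹ • B).PosSemidef :=
      (Matrix.nonneg_iff_posSemidef.mp hB).smul
        (by rw [← Complex.ofReal_inv]; exact_mod_cast (inv_pos.mpr hc).le)
    have hle : B ≤ algebraMap ℝ (Matrix ι ι ℂ) (‖B‖ + 1) := by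
      rw [map_add, map_one]
      exact (IsSelfAdjoint.of_nonneg hB).le_algebraMap_norm_self.trans
        (le_add_of_nonneg_right zero_le_one)
    have hB'' : (1 - ((‖B‖ + 1 : ℝ) : ℂ)⁻¹ • B).PosSemidef := by
      have h := (Matrix.le_iff.mp hle).smul (a := ((‖B‖ + 1 : ℝ) : ℂ)⁻¹)
        (by rw [← Complex.ofReal_inv]; exact_mod_cast (inv_pos.mpr hc).le)
      have e : algebraMap ℝ (Matrix ι ι ℂ) (‖B‖ + 1) = ((‖B‖ + 1 : ℝ) : ℂ) • 1 := by
        rw [Algebra.algebraMap_eq_smul_one, ← Complex.coe_smul]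
      rwa [smul_sub, e, inv_smul_smul₀ hc'] at h
    have := slice_eq_smul_of_le_one hN hτ hB' hB'' j
    simp only [slice_smul, Matrix.trace_smul, smul_eq_mul, mul_smul] at this
    exact (smul_right_injective _ (inv_ne_zero hc')) this
  | zero =>
    ext a b
    simp [slice_apply, Matrix.trace]
  | add B C _ _ hB hC => rw [slice_add, slice_add, hB, hC, Matrix.trace_add, add_smul]
  | smul c B _ hB => rw [slice_smul, slice_smul, hB, Matrix.trace_smul, smul_eq_mul, mul_smul]

/-- The one-particle member of a family, indexed by `ι`. -/
def singleMarginal (τ : MatrixFamily ι) : Matrix ι ι ℂ :=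
  (τ 1).submatrix (fun i _ => i) (fun i _ => i)

theorem apply_eq_prod_of_extreme [DecidableEq ι] (hN : IsSymmetricIdealFamily N)
    {τ : MatrixFamily ι} (hτ : τ ∈ (compatibleFamilies N).extremePoints ℝ) {j : ℕ}
    (a b : Fin j → ι) : τ j a b = ∏ k, singleMarginal τ (a k) (b k) := by
  induction j with
  | zero =>
    rw [Fin.prod_univ_zero, ← hτ.1.2, Matrix.trace, Fintype.sum_unique]
    congr 1 <;> exact Subsingleton.elim _ _
  | succ j ih =>
    have h (i l : ι) : (slice (Matrix.single i l 1) (τ 1)).trace = singleMarginal τ i l := by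
      rw [Matrix.trace, Fintype.sum_unique, Matrix.diag_apply, slice_single]
      simp only [singleMarginal, Matrix.submatrix_apply]
      congr 1 <;> · funext k; rw [Fin.fin_one_eq_zero k]; rfl
    -- Slicing with a matrix unit reads off an entry in the first factor, so proportionality splits
    -- off one factor of the product.
    have := congrFun₂ (slice_eq_smul_of_extreme hN hτ (Matrix.single (a 0) (b 0) 1) j)
      (Fin.tail a) (Fin.tail b)
    rw [slice_single, Fin.cons_self_tail, Fin.cons_self_tail, h, Matrix.smul_apply, ih] at this
    rw [this, Fin.prod_univ_succ]
    rfl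

/-- The hypothesis `hcomm` says that all `2 × 2` minors vanish, so `R` has rank one; `ψ` is a column
through a nonzero diagonal entry, divided by the square root of that entry. -/
theorem exists_eq_vecMulVec_of_mul_comm {R : Matrix ι ι ℂ} (hR : R.PosSemidef)
    (htr : R.trace = 1) (hcomm : ∀ i k l m, R i l * R k m = R k l * R i m) :
    ∃ ψ : ι → ℂ, R = Matrix.vecMulVec ψ (star ψ) := by
  obtain ⟨m, hm⟩ : ∃ m, R m m ≠ 0 := by
    by_contra! h
    simp [Matrix.trace, h] at htr
  have hpos : 0 < R m m := lt_of_le_of_ne hR.diag_nonneg hm.symm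
  obtain ⟨r, hr, hrm⟩ : ∃ r : ℝ, 0 < r ∧ R m m = r :=
    ⟨_, (Complex.pos_iff.mp hpos).1,
      Complex.eq_re_of_ofReal_le (r := 0) (by simpa using hpos.le)⟩
  have hsq : ((Real.sqrt r : ℝ) : ℂ) * (Real.sqrt r : ℝ) = r := by
    rw [← Complex.ofReal_mul, Real.mul_self_sqrt hr.le]
  have hr' : (r : ℂ) ≠ 0 := by exact_mod_cast hr.ne'
  refine ⟨fun i => R i m / (Real.sqrt r : ℝ), ?_⟩
  ext i l
  have h := hcomm i m l m
  have hl : star (R l m) = R m l := hR.isHermitian.apply m l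
  rw [Matrix.vecMulVec_apply, Pi.star_apply, star_div₀, hl, Complex.star_def, Complex.conj_ofReal,
    div_mul_div_comm, hsq, eq_div_iff hr', ← hrm, h, mul_comm]

/-- The unit vectors of `ℂ^ι` whose powers are annihilated by `N`. -/
def zeroSphere (N : ∀ j : ℕ, Set ((Fin j → ι) → ℂ)) : Set (ι → ℂ) :=
  {ψ | ∑ i, ψ i * star (ψ i) = 1 ∧ ∀ j, ∀ u ∈ N j, ∑ a, u a * ∏ k, ψ (a k) = 0}

/-- The rank-one projections onto the vectors of `zeroSphere N`. -/
def zeroProjections (N : ∀ j : ℕ, Set ((Fin j → ι) → ℂ)) : Set (Matrix ι ι ℂ) :=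
  (fun ψ => Matrix.vecMulVec ψ (star ψ)) '' zeroSphere N

theorem singleMarginal_mem_of_extreme [DecidableEq ι] (hN : IsSymmetricIdealFamily N)
    {τ : MatrixFamily ι} (hτ : τ ∈ (compatibleFamilies N).extremePoints ℝ) :
    singleMarginal τ ∈ zeroProjections N := by
  obtain ⟨hc, h1⟩ := hτ.1
  have hprod {j : ℕ} (a b : Fin j → ι) : τ j a b = ∏ k, singleMarginal τ (a k) (b k) :=
    apply_eq_prod_of_extreme hN hτ a b
  have hpos : (singleMarginal τ).PosSemidef := (hc 1).posSemidef.submatrix _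
  have htr : (singleMarginal τ).trace = 1 := by
    rw [← h1, ← trace_eq_trace_zero (j := 1) fun i _ => hc i, Matrix.trace, Matrix.trace]
    exact (Equiv.funUnique (Fin 1) ι).symm.sum_comp fun a => τ 1 a a
  -- The two-particle member is `R ⊗ R`, and its range is symmetric; exchanging only the row indices
  -- gives the vanishing of the minors.
  obtain ⟨ψ, hψ⟩ := exists_eq_vecMulVec_of_mul_comm hpos htr fun i k l m => by
    have := apply_cons_cons_comm hN (hc 2).annihilates i k Fin.elim0
      (Fin.cons l (Fin.cons m Fin.elim0))
    simpa [hprod, Fin.prod_univ_succ] using this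
  have hψ1 : ∑ i, ψ i * star (ψ i) = 1 := by
    rw [← htr, hψ]
    rfl
  refine ⟨ψ, ⟨hψ1, fun j u hu => ?_⟩, hψ.symm⟩
  obtain ⟨m, hm⟩ : ∃ m, ψ m ≠ 0 := by
    by_contra! h
    simp [h] at hψ1
  -- In the column with constant index `m`, the power of `ψ` appears multiplied by the nonzero
  -- scalar `star (ψ m) ^ j`.
  have := (hc j).annihilates u hu fun _ => m
  simp only [hprod, hψ, Matrix.vecMulVec_apply, Finset.prod_mul_distrib, ← mul_assoc,
    ← Finset.sum_mul] at this
  refine (mul_eq_zero.mp this).resolve_right ?_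
  simp [hm]

theorem isCompact_zeroSphere : IsCompact (zeroSphere N) := by
  have hK : IsCompact (Set.pi Set.univ fun _ : ι => Metric.closedBall (0 : ℂ) 1) :=
    isCompact_univ_pi fun _ => isCompact_closedBall _ _
  refine hK.of_isClosed_subset ?_ ?_
  · simp only [zeroSphere, Set.ofPred_and, Set.ofPred_forall]
    refine (isClosed_eq (by fun_prop) (by fun_prop)).inter ?_
    exact isClosed_iInter fun j => isClosed_iInter fun u => isClosed_iInter fun _ =>
      isClosed_eq (by fun_prop) (by fun_prop)
  · rintro ψ ⟨h, -⟩ i -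
    rw [mem_closedBall_zero_iff]
    have h' : ∑ i, ‖ψ i‖ ^ 2 = 1 := by
      simp only [Complex.star_def, Complex.mul_conj, Complex.normSq_eq_norm_sq] at h
      exact_mod_cast h
    have := Finset.single_le_sum (f := fun i => ‖ψ i‖ ^ 2) (fun _ _ => sq_nonneg _)
      (Finset.mem_univ i)
    exact (sq_le_one_iff₀ (norm_nonneg _)).mp (this.trans_eq h')

theorem isCompact_convexHull_zeroProjections :
    IsCompact (convexHull ℝ (zeroProjections N)) := by
  have : IsCompact (zeroProjections N) := isCompact_zeroSphere.image (by fun_prop)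
  exact isCompact_convexHull_of_isCompact this

instance : LocallyConvexSpace ℝ (MatrixFamily ι) :=
  inferInstanceAs (LocallyConvexSpace ℝ (∀ j : ℕ, (Fin j → ι) → (Fin j → ι) → ℂ))

theorem singleMarginal_mem_convexHull [DecidableEq ι] (hN : IsSymmetricIdealFamily N)
    {τ : MatrixFamily ι} (hτ : τ ∈ compatibleFamilies N) :
    singleMarginal τ ∈ convexHull ℝ (zeroProjections N) := by
  let f : MatrixFamily ι →L[ℝ] Matrix ι ι ℂ :=
    { toFun := singleMarginal
      map_add' := fun _ _ => rfl
      map_smul' := fun _ _ => rfl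
      cont := by unfold singleMarginal; fun_prop }
  -- Krein–Milman. The closure is harmless because the target hull is compact, hence has closed
  -- preimage under `f`.
  rw [← closure_convexHull_extremePoints isCompact_compatibleFamilies convex_compatibleFamilies]
    at hτ
  have hsub : convexHull ℝ ((compatibleFamilies N).extremePoints ℝ) ⊆
      f ⁻¹' convexHull ℝ (zeroProjections N) :=
    convexHull_min (fun σ hσ => subset_convexHull ℝ _ (singleMarginal_mem_of_extreme hN hσ))
      ((convex_convexHull ℝ _).linear_preimage f.toLinearMap)
  exact closure_minimal hsub
    (isCompact_convexHull_zeroProjections.isClosed.preimage f.continuous) hτ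

end ExtremePoints

/-! ### From tensions of every order to one infinite family -/

section Existence

open scoped ComplexOrder Matrix

variable {ι : Type*} [Fintype ι] {N : ∀ j : ℕ, Set ((Fin j → ι) → ℂ)}

/-- The members below `n` are the iterated marginals of `M`, since the marginal is the slice by `1`.
Those above `n` are set to zero: no condition for `j < n` involves them, and the entry bound still
holds. -/
theorem exists_compatibleAt_lt [DecidableEq ι] (hN : IsSymmetricIdealFamily N) (n : ℕ)
    {M : Matrix (Fin n → ι) (Fin n → ι) ℂ} (hM : M.PosSemidef) (hM' : Annihilates (N n) M)
    (htr : M.trace = 1) :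
    ∃ τ : MatrixFamily ι, τ n = M ∧ (∀ j < n, CompatibleAt N τ j) ∧ ∀ j a b, ‖τ j a b‖ ≤ 1 := by
  induction n with
  | zero =>
    refine ⟨Function.update 0 0 M, by simp, by simp, fun j a b => ?_⟩
    obtain rfl | hj := eq_or_ne j 0
    · simpa using norm_apply_le_of_posSemidef hM htr a b
    · simp [Function.update_of_ne hj]
  | succ n ih =>
    obtain ⟨τ, hτ, hc, hb⟩ := ih (posSemidef_slice Matrix.PosSemidef.one hM)
      (annihilates_slice hN 1 hM') ((trace_slice_one M).trans htr)
    refine ⟨Function.update τ (n + 1) M, by simp, fun j hj => ?_, fun j a b => ?_⟩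
    · have hj' : Function.update τ (n + 1) M j = τ j := Function.update_of_ne hj.ne _ _
      obtain rfl | hjn := eq_or_ne j n
      · refine ⟨?_, ?_, fun a b => ?_⟩
        · rw [hj', hτ]
          exact posSemidef_slice Matrix.PosSemidef.one hM
        · rw [hj', hτ]
          exact annihilates_slice hN 1 hM'
        · rw [hj', hτ, Function.update_self, slice_one]
      · have h := hc j (by omega)
        refine ⟨by rw [hj']; exact h.1, by rw [hj']; exact h.2, fun a b => ?_⟩
        rw [hj', Function.update_of_ne (by omega)]
        exact h.3 a b
    · obtain rfl | hj := eq_or_ne j (n + 1)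
      · simpa using norm_apply_le_of_posSemidef hM htr a b
      · simpa [Function.update_of_ne hj] using hb j a b

/-- Compatibility traces out first factors one at a time, so the factor that survives is the last
one, the same as the one kept by `partialTrace`. -/
theorem singleMarginal_apply_eq_sum_snoc {τ : MatrixFamily ι} {k : ℕ}
    (hτ : ∀ j < k + 1, CompatibleAt N τ j) (i l : ι) :
    singleMarginal τ i l =
      ∑ c : Fin k → ι, τ (k + 1) (Fin.snoc c i : Fin (k + 1) → ι) (Fin.snoc c l) := by
  induction k with
  | zero =>
    rw [Fintype.sum_unique]
    simp only [singleMarginal, Matrix.submatrix_apply]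
    congr 1
  | succ k ih =>
    rw [ih fun j hj => hτ j (by omega), sum_fin_succ_fun, Finset.sum_comm]
    refine Finset.sum_congr rfl fun c _ => ?_
    rw [← (hτ (k + 1) (by omega)).marginal]
    simp only [Fin.cons_snoc_eq_snoc_cons]

/-- If for all `k` the matrix `R` is a marginal of a `(k+1)`-particle state that is annihilated
by `N`, then it is a convex combination of projections onto product zeros of `N`. -/
theorem mem_convexHull_zeroProjections [DecidableEq ι] (hN : IsSymmetricIdealFamily N) {R : Matrix ι ι ℂ}
    (h : ∀ k : ℕ, ∃ M : Matrix (Fin (k + 1) → ι) (Fin (k + 1) → ι) ℂ,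
      M.PosSemidef ∧ M.trace = 1 ∧ Annihilates (N (k + 1)) M ∧
      ∀ i l, ∑ c : Fin k → ι, M (Fin.snoc c i : Fin (k + 1) → ι) (Fin.snoc c l) = R i l) :
    R ∈ convexHull ℝ (zeroProjections N) := by
  -- Families with one-particle marginal `R` that are consistent up to level `n + 1`: a decreasing
  -- sequence of nonempty closed sets in a compact set, whose common point is consistent at all
  -- levels.
  let t (n : ℕ) : Set (MatrixFamily ι) :=
    (⋂ j < n + 1, {τ | CompatibleAt N τ j}) ∩
      ({τ | (τ 0).trace = 1 ∧ singleMarginal τ = R} ∩ {τ | ∀ j a b, ‖τ j a b‖ ≤ 1})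
  have ht (n : ℕ) : IsClosed (t n) := by
    refine (isClosed_biInter fun j _ => isClosed_compatibleAt j).inter (IsClosed.inter ?_
      (isCompact_norm_apply_le_one ι).isClosed)
    unfold singleMarginal
    exact (isClosed_eq (by fun_prop) (by fun_prop)).inter (isClosed_eq (by fun_prop) (by fun_prop))
  obtain ⟨τ, hτ⟩ := IsCompact.nonempty_iInter_of_sequence_nonempty_isCompact_isClosed t
    (fun n => Set.inter_subset_inter_left _
      (Set.biInter_subset_biInter_left fun j (hj : j < n + 1) => (by
        change j < n + 1 + 1
        omega)))
    (fun n => by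
      obtain ⟨M, hM, htr, hM', hR⟩ := h n
      obtain ⟨τ, rfl, hc, hb⟩ := exists_compatibleAt_lt hN (n + 1) hM hM' htr
      refine ⟨τ, Set.mem_iInter₂.mpr hc, ⟨(trace_eq_trace_zero hc).symm.trans htr, ?_⟩, hb⟩
      ext i l
      rw [singleMarginal_apply_eq_sum_snoc hc, hR])
    ((isCompact_norm_apply_le_one ι).of_isClosed_subset (ht 0) fun τ hτ => hτ.2.2) ht
  rw [Set.mem_iInter] at hτ
  rw [← (hτ 0).2.1.2]
  exact singleMarginal_mem_convexHull hN
    ⟨fun j => Set.mem_iInter₂.mp (hτ j).1 j j.lt_succ_self, (hτ 0).2.1.1⟩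

end Existence

variable {H : Type*} [NormedAddCommGroup H] [InnerProductSpace ℂ H]

/-! ### Symmetric tensors, polynomials and the inclusion of `X^k` in `I_k^⊥` -/

section Polynomials

theorem tensorToPoly_tprod {k : ℕ} (ℓ : Fin k → Module.Dual ℂ H) :
    tensorToPoly H k (PiTensorProduct.tprod ℂ ℓ) = ∏ i, SymmetricAlgebra.ι ℂ _ (ℓ i) := by
  simp [tensorToPoly]

theorem evalAt_ι (ψ : H) (ℓ : Module.Dual ℂ H) :
    evalAt ψ (SymmetricAlgebra.ι ℂ _ ℓ) = ℓ ψ := by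
  simp [evalAt]

theorem dualDistrib_tprod_const {k : ℕ} (f : ⨂[ℂ]^k (Module.Dual ℂ H)) (ψ : H) :
    PiTensorProduct.dualDistrib (M := fun _ : Fin k => H) f (PiTensorProduct.tprod ℂ fun _ => ψ)
      = evalAt ψ (tensorToPoly H k f) := by
  induction f using PiTensorProduct.induction_on with
  | smul_tprod r ℓ =>
    simp [tensorToPoly_tprod, evalAt_ι, PiTensorProduct.dualDistrib_apply]
  | add f g hf hg => simp [hf, hg]

theorem tensorToPoly_reindex {k : ℕ} (π : Equiv.Perm (Fin k)) (f : ⨂[ℂ]^k (Module.Dual ℂ H)) :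
    tensorToPoly H k (PiTensorProduct.reindex ℂ (fun _ => Module.Dual ℂ H) π f) =
      tensorToPoly H k f := by
  induction f using PiTensorProduct.induction_on with
  | smul_tprod r ℓ =>
    rw [map_smul, map_smul, map_smul, PiTensorProduct.reindex_tprod, tensorToPoly_tprod,
      tensorToPoly_tprod]
    congr 1
    exact π.symm.prod_comp fun i => SymmetricAlgebra.ι ℂ _ (ℓ i)
  | add f g hf hg => simp only [map_add, hf, hg]

theorem dualDistrib_reindex {k : ℕ} (π : Equiv.Perm (Fin k)) (f : ⨂[ℂ]^k (Module.Dual ℂ H))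
    (v : ⨂[ℂ]^k H) :
    PiTensorProduct.dualDistrib (M := fun _ : Fin k => H)
        (PiTensorProduct.reindex ℂ (fun _ => Module.Dual ℂ H) π f)
        (PiTensorProduct.reindex ℂ (fun _ => H) π v) =
      PiTensorProduct.dualDistrib (M := fun _ : Fin k => H) f v := by
  induction f using PiTensorProduct.induction_on with
  | smul_tprod r ℓ =>
    induction v using PiTensorProduct.induction_on with
    | smul_tprod s x =>
      simp only [map_smul, LinearMap.smul_apply, PiTensorProduct.reindex_tprod]
      congr 2
      exact (PiTensorProduct.dualDistrib_apply _ _).trans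
        ((π.symm.prod_comp fun i => ℓ i (x i)).trans
          (PiTensorProduct.dualDistrib_apply _ _).symm)
    | add v w hv hw => simp only [map_add, hv, hw]
  | add f g hf hg => simp only [map_add, LinearMap.add_apply, hf, hg]

/-- The projection of `V^{⊗k}` onto the symmetric tensors. -/
def symmetrize (V : Type*) [AddCommGroup V] [Module ℂ V] (k : ℕ) : (⨂[ℂ]^k V) →ₗ[ℂ] ⨂[ℂ]^k V :=
  (k.factorial : ℂ)⁻¹ • ∑ π : Equiv.Perm (Fin k),
    (PiTensorProduct.reindex ℂ (fun _ : Fin k => V) π).toLinearMap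

theorem symmetrize_apply {V : Type*} [AddCommGroup V] [Module ℂ V] {k : ℕ} (f : ⨂[ℂ]^k V) :
    symmetrize V k f = (k.factorial : ℂ)⁻¹ • ∑ π : Equiv.Perm (Fin k),
      PiTensorProduct.reindex ℂ (fun _ : Fin k => V) π f := by
  simp [symmetrize, LinearMap.sum_apply]

theorem mem_symSubspace {V : Type*} [AddCommGroup V] [Module ℂ V] {k : ℕ} {f : ⨂[ℂ]^k V} :
    f ∈ symSubspace V k ↔
      ∀ π : Equiv.Perm (Fin k), PiTensorProduct.reindex ℂ (fun _ : Fin k => V) π f = f := by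
  simp [symSubspace, Submodule.mem_iInf, LinearMap.mem_eqLocus]

theorem symmetrize_mem {V : Type*} [AddCommGroup V] [Module ℂ V] {k : ℕ} (f : ⨂[ℂ]^k V) :
    symmetrize V k f ∈ symSubspace V k := by
  rw [mem_symSubspace]
  intro π
  rw [symmetrize_apply, map_smul, map_sum]
  congr 1
  refine Fintype.sum_equiv (Equiv.mulLeft π) _ _ fun π' => ?_
  exact PiTensorProduct.reindex_reindex (R := ℂ) (s := fun _ : Fin k => V) π' π f

theorem sum_perm_const (k : ℕ) {M : Type*} [AddCommGroup M] [Module ℂ M] (x : M) :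
    (k.factorial : ℂ)⁻¹ • ∑ _π : Equiv.Perm (Fin k), x = x := by
  have : (k.factorial : ℂ) ≠ 0 := by exact_mod_cast k.factorial_ne_zero
  rw [Finset.sum_const, Finset.card_univ, Fintype.card_perm, Fintype.card_fin,
    ← Nat.cast_smul_eq_nsmul ℂ, inv_smul_smul₀ this]

theorem tensorToPoly_symmetrize {k : ℕ} (f : ⨂[ℂ]^k (Module.Dual ℂ H)) :
    tensorToPoly H k (symmetrize _ k f) = tensorToPoly H k f := by
  rw [symmetrize_apply, map_smul, map_sum]
  simp only [tensorToPoly_reindex]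
  exact sum_perm_const k _

theorem dualDistrib_symmetrize {k : ℕ} (f : ⨂[ℂ]^k (Module.Dual ℂ H)) {v : ⨂[ℂ]^k H}
    (hv : v ∈ symSubspace H k) :
    PiTensorProduct.dualDistrib (M := fun _ : Fin k => H) (symmetrize _ k f) v =
      PiTensorProduct.dualDistrib (M := fun _ : Fin k => H) f v := by
  have h (π : Equiv.Perm (Fin k)) : PiTensorProduct.dualDistrib (M := fun _ : Fin k => H)
      (PiTensorProduct.reindex ℂ (fun _ => Module.Dual ℂ H) π f) v =
      PiTensorProduct.dualDistrib (M := fun _ : Fin k => H) f v := by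
    rw [← dualDistrib_reindex π f v, mem_symSubspace.mp hv π]
  rw [symmetrize_apply, map_smul, map_sum, LinearMap.smul_apply, LinearMap.sum_apply]
  simp only [h]
  exact sum_perm_const k _

/-- Vectors of `I_k^⊥` are annihilated by all, not only the symmetric, tensors that represent
elements of `I`. -/
theorem dualDistrib_eq_zero_of_mem_perp {I : Ideal (PolyRing H)} {k : ℕ} {v : TensorPow H k}
    (hv : v ∈ perp I k) {f : ⨂[ℂ]^k (Module.Dual ℂ H)} (hf : tensorToPoly H k f ∈ I) :
    PiTensorProduct.dualDistrib (M := fun _ : Fin k => H) f (TensorPow.toTensor H k v) = 0 := by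
  obtain ⟨hsym, hker⟩ := Submodule.mem_inf.mp (Submodule.mem_comap.mp hv)
  refine (dualDistrib_symmetrize f hsym).symm.trans ?_
  refine (Submodule.mem_iInf _).mp ((Submodule.mem_iInf _).mp hker (symmetrize _ k f)) ?_
  refine Submodule.mem_inf.mpr ⟨symmetrize_mem f, ?_⟩
  change tensorToPoly H k (symmetrize _ k f) ∈ I
  rwa [tensorToPoly_symmetrize]

theorem ketbra_apply (ψ φ : H) : ketbra ψ φ = inner ℂ ψ φ • ψ := rfl

theorem ketbra_self_apply {ψ : H} (hψ : ‖ψ‖ = 1) : ketbra ψ ψ = ψ := by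
  rw [ketbra_apply, inner_self_eq_norm_sq_to_K, hψ]
  simp

/-- Pairing a tensor with a power `ψ^{⊗k}` evaluates its polynomial at `ψ`. -/
theorem powerSpan_le_perp (I : Ideal (PolyRing H)) (k : ℕ) :
    powerSpan (variety I) k ≤ perp I k := by
  refine Submodule.span_le.mpr ?_
  rintro - ⟨φ, ⟨ψ, hψ, hI, hφψ⟩, rfl⟩
  -- A projection determines its vector only up to a scalar: `φ` spans the line of the zero `ψ`, and
  -- the scalar enters the pairing as a nonzero `k`-th power.
  have hc : inner ℂ φ ψ • φ = ψ := by
    rw [← ketbra_apply, hφψ, ketbra_self_apply hψ]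
  have hc0 : inner ℂ φ ψ ≠ 0 := by
    intro h
    rw [h, zero_smul] at hc
    simp [← hc] at hψ
  refine Submodule.mem_comap.mpr (Submodule.mem_inf.mpr ⟨mem_symSubspace.mpr fun π => ?_, ?_⟩)
  · exact PiTensorProduct.reindex_tprod π _
  · simp only [Submodule.mem_iInf]
    rintro f ⟨-, hf⟩
    have h := (dualDistrib_tprod_const f ψ).trans (hI _ hf)
    have hs : PiTensorProduct.tprod ℂ (fun _ : Fin k => ψ) =
        (∏ _i : Fin k, inner ℂ φ ψ) • PiTensorProduct.tprod ℂ (fun _ : Fin k => φ) := by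
      rw [← MultilinearMap.map_smul_univ, hc]
    rw [hs, map_smul, smul_eq_zero] at h
    exact h.resolve_left (Finset.prod_ne_zero_iff.mpr fun _ _ => hc0)

theorem splitLast_tmul {k : ℕ} (x : Fin k → H) (y : H) :
    splitLast H k (PiTensorProduct.tprod ℂ x ⊗ₜ y) =
      TensorPow.tprod (Fin.snoc x y : Fin (k + 1) → H) := by
  have h1 : (PiTensorProduct.subsingletonEquiv (R := ℂ) (s := fun _ : Fin 1 => H) 0).symm y =
      PiTensorProduct.tprod ℂ fun _ => y := by
    rw [LinearEquiv.symm_apply_eq]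
    simp
  have h2 := TensorPower.tprod_mul_tprod ℂ x fun _ : Fin 1 => y
  rw [TensorPower.gMul_def] at h2
  simp only [splitLast, LinearEquiv.trans_apply, LinearEquiv.lTensor_tmul, h1, h2, TensorPow.tprod,
    Fin.append_right_eq_snoc]

end Polynomials

/-! ### Translation into coordinates of an orthonormal basis -/

section Basis

open scoped ComplexOrder Matrix

variable [FiniteDimensional ℂ H]

/-- The coordinate functions of an orthonormal basis, as polynomials. -/
def coordVar (H : Type*) [NormedAddCommGroup H] [InnerProductSpace ℂ H] [FiniteDimensional ℂ H]
    (i : Fin (Module.finrank ℂ H)) : PolyRing H :=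
  SymmetricAlgebra.ι ℂ _ ((stdOrthonormalBasis ℂ H).toBasis.coord i)

/-- The coefficient tensors of length `j` that represent elements of `I`. -/
def coordIdeal (I : Ideal (PolyRing H)) (j : ℕ) :
    Set ((Fin j → Fin (Module.finrank ℂ H)) → ℂ) :=
  {u | ∑ a, u a • ∏ k, coordVar H (a k) ∈ I}

/-- Tensoring from the left by a basis vector multiplies the polynomial by a coordinate, and the
exchange differences represent the zero polynomial because multiplication is commutative. -/
theorem isSymmetricIdealFamily_coordIdeal (I : Ideal (PolyRing H)) :
    IsSymmetricIdealFamily (coordIdeal I) where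
  cons_mem j u hu i := by
    have : ∑ w : Fin (j + 1) → Fin (Module.finrank ℂ H),
        (if w 0 = i then u (Fin.tail w) else 0) • ∏ k, coordVar H (w k) =
        coordVar H i * ∑ a, u a • ∏ k, coordVar H (a k) := by
      simp [sum_fin_succ_fun, Fin.prod_univ_succ, Finset.mul_sum, ite_smul,
        Finset.sum_ite_irrel]
    change _ ∈ I
    rw [this]
    exact I.mul_mem_left _ hu
  swap_mem j a i k := by
    change _ ∈ I
    simp [sub_smul, Finset.sum_sub_distrib, Pi.single_apply, ite_smul, Fin.prod_univ_succ,
      mul_left_comm (coordVar H k)]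

theorem evalAt_sum_coordVar (ψ : H) {j : ℕ} (u : (Fin j → Fin (Module.finrank ℂ H)) → ℂ) :
    evalAt ψ (∑ a, u a • ∏ k, coordVar H (a k)) =
      ∑ a, u a * ∏ k, (stdOrthonormalBasis ℂ H).toBasis.repr ψ (a k) := by
  simp [coordVar, evalAt_ι]

/-- The tensor with coefficients `u` in the dual product basis. -/
def coordTensor {j : ℕ} (u : (Fin j → Fin (Module.finrank ℂ H)) → ℂ) :
    ⨂[ℂ]^j (Module.Dual ℂ H) :=
  ∑ a, u a • PiTensorProduct.tprod ℂ fun k => (stdOrthonormalBasis ℂ H).toBasis.coord (a k)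

theorem tensorToPoly_coordTensor {j : ℕ} (u : (Fin j → Fin (Module.finrank ℂ H)) → ℂ) :
    tensorToPoly H j (coordTensor u) = ∑ a, u a • ∏ k, coordVar H (a k) := by
  simp [coordTensor, tensorToPoly_tprod, coordVar]

theorem exists_coordTensor_eq {j : ℕ} (f : ⨂[ℂ]^j (Module.Dual ℂ H)) :
    ∃ u, coordTensor u = f := by
  let B := Basis.piTensorProduct fun _ : Fin j => (stdOrthonormalBasis ℂ H).toBasis.dualBasis
  refine ⟨fun a => B.repr f a, ?_⟩
  conv_rhs => rw [← B.sum_repr f]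
  simp [coordTensor, B]

theorem repr_tprod {j : ℕ} (x : Fin j → H) (a : Fin j → Fin (Module.finrank ℂ H)) :
    (TensorPow.basis H j).repr (TensorPow.tprod x) a =
      ∏ k, (stdOrthonormalBasis ℂ H).toBasis.repr (x k) (a k) := by
  simp [TensorPow.basis, TensorPow.tprod, Basis.piTensorProduct_repr_tprod_apply]

/-- This turns orthogonality to `I` under the bilinear pairing into the condition `Annihilates`; no
conjugation enters. -/
theorem dualDistrib_coordTensor {j : ℕ} (u : (Fin j → Fin (Module.finrank ℂ H)) → ℂ)
    (v : TensorPow H j) :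
    PiTensorProduct.dualDistrib (M := fun _ : Fin j => H) (coordTensor u)
      (TensorPow.toTensor H j v) = ∑ a, u a * (TensorPow.basis H j).repr v a := by
  obtain ⟨v, rfl⟩ := (TensorPow.toTensor H j).symm.surjective v
  rw [LinearEquiv.apply_symm_apply]
  induction v using PiTensorProduct.induction_on with
  | smul_tprod r x =>
    have h := repr_tprod x
    simp only [TensorPow.tprod] at h
    simp [coordTensor, h, LinearMap.sum_apply, PiTensorProduct.dualDistrib_apply,
      Finset.mul_sum, mul_left_comm r]
  | add v w hv hw => simp [hv, hw, mul_add, Finset.sum_add_distrib]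

/-- The product basis of the tensor power is orthonormal. -/
def TensorPow.orthonormalBasis (H : Type*) [NormedAddCommGroup H] [InnerProductSpace ℂ H]
    [FiniteDimensional ℂ H] (k : ℕ) :
    OrthonormalBasis (Fin k → Fin (Module.finrank ℂ H)) ℂ (TensorPow H k) :=
  (TensorPow.basis H k).toOrthonormalBasis <| by
    rw [orthonormal_iff_ite]
    intro v w
    change ∑ a, (starRingEnd ℂ) ((TensorPow.basis H k).repr (TensorPow.basis H k v) a)
      * (TensorPow.basis H k).repr (TensorPow.basis H k w) a = _
    simp [Finsupp.single_apply]

theorem TensorPow.orthonormalBasis_toBasis (k : ℕ) :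
    (TensorPow.orthonormalBasis H k).toBasis = TensorPow.basis H k :=
  Module.Basis.toBasis_toOrthonormalBasis _ _

theorem repr_splitLast_tmul {k : ℕ} (v : ⨂[ℂ]^k H) (y : H)
    (c : Fin k → Fin (Module.finrank ℂ H)) (i : Fin (Module.finrank ℂ H)) :
    (TensorPow.basis H (k + 1)).repr (splitLast H k (v ⊗ₜ y)) (Fin.snoc c i) =
      (Basis.piTensorProduct fun _ : Fin k => (stdOrthonormalBasis ℂ H).toBasis).repr v c *
        (stdOrthonormalBasis ℂ H).toBasis.repr y i := by
  induction v using PiTensorProduct.induction_on with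
  | smul_tprod r x =>
    rw [← TensorProduct.smul_tmul', map_smul, map_smul, map_smul, splitLast_tmul,
      Finsupp.smul_apply, Finsupp.smul_apply, repr_tprod, Fin.prod_univ_castSucc,
      Basis.piTensorProduct_repr_tprod_apply]
    simp [mul_assoc]
  | add v w hv hw =>
    rw [TensorProduct.add_tmul, map_add, map_add, map_add, Finsupp.add_apply, Finsupp.add_apply,
      hv, hw, add_mul]

theorem toMatrix_partialTrace {k : ℕ} (σ : Module.End ℂ (TensorPow H (k + 1)))
    (i l : Fin (Module.finrank ℂ H)) :
    LinearMap.toMatrix (stdOrthonormalBasis ℂ H).toBasis (stdOrthonormalBasis ℂ H).toBasis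
        (partialTrace H k σ) i l =
      ∑ c : Fin k → Fin (Module.finrank ℂ H),
        LinearMap.toMatrix (TensorPow.basis H (k + 1)) (TensorPow.basis H (k + 1)) σ
          (Fin.snoc c i) (Fin.snoc c l) := by
  -- Both sides are linear in `σ`, so operators of the form `A ⊗ B` suffice.
  obtain ⟨t, rfl⟩ := ((homTensorHomEquiv ℂ (⨂[ℂ]^k H) H (⨂[ℂ]^k H) H).trans
    (splitLast H k).conj).surjective σ
  induction t with
  | zero => simp
  | add s t hs ht =>
    simp only [map_add, Matrix.add_apply, hs, ht, Finset.sum_add_distrib]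
  | tmul A B =>
    have hp : partialTrace H k (((homTensorHomEquiv ℂ (⨂[ℂ]^k H) H (⨂[ℂ]^k H) H).trans
        (splitLast H k).conj) (A ⊗ₜ B)) = LinearMap.trace ℂ _ A • B := by
      rw [partialTrace, LinearMap.comp_apply, LinearMap.comp_apply, LinearMap.comp_apply,
        LinearEquiv.trans_apply, LinearEquiv.coe_coe, LinearEquiv.coe_coe, LinearEquiv.coe_coe,
        LinearEquiv.conj_symm_conj, LinearEquiv.symm_apply_apply,
        TensorProduct.map_tmul, TensorProduct.lid_tmul, LinearMap.id_apply]
    let b := Basis.piTensorProduct fun _ : Fin k => (stdOrthonormalBasis ℂ H).toBasis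
    have hb (c : Fin k → Fin (Module.finrank ℂ H)) :
        (splitLast H k).symm (TensorPow.basis H (k + 1) (Fin.snoc c l)) =
          b c ⊗ₜ (stdOrthonormalBasis ℂ H).toBasis l := by
      rw [LinearEquiv.symm_apply_eq]
      simp only [b, Basis.piTensorProduct_apply, splitLast_tmul]
      simp only [TensorPow.basis, TensorPow.tprod, Module.Basis.map_apply,
        Basis.piTensorProduct_apply]
      congr 2
      funext k
      refine Fin.lastCases ?_ (fun k => ?_) k <;> simp
    rw [hp, map_smul, Matrix.smul_apply, LinearMap.trace_eq_matrix_trace ℂ b, Matrix.trace,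
      smul_eq_mul, Finset.sum_mul]
    refine Finset.sum_congr rfl fun c _ => ?_
    rw [LinearMap.toMatrix_apply, LinearMap.toMatrix_apply, LinearEquiv.trans_apply,
      LinearEquiv.conj_apply_apply, hb, homTensorHomEquiv_apply, TensorProduct.homTensorHomMap_apply,
      TensorProduct.map_tmul, repr_splitLast_tmul, Matrix.diag_apply, LinearMap.toMatrix_apply]

theorem toMatrix_ketbra (ψ : H) (i l : Fin (Module.finrank ℂ H)) :
    LinearMap.toMatrix (stdOrthonormalBasis ℂ H).toBasis (stdOrthonormalBasis ℂ H).toBasis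
        (ketbra ψ) i l =
      (stdOrthonormalBasis ℂ H).toBasis.repr ψ i *
        star ((stdOrthonormalBasis ℂ H).toBasis.repr ψ l) := by
  rw [LinearMap.toMatrix_apply, ketbra_apply]
  simp [OrthonormalBasis.repr_apply_apply, mul_comm]

theorem toMatrix_ketbra_tensorPow {k : ℕ} (v : TensorPow H k)
    (a b : Fin k → Fin (Module.finrank ℂ H)) :
    LinearMap.toMatrix (TensorPow.basis H k) (TensorPow.basis H k) (ketbra v) a b =
      (TensorPow.basis H k).repr v a * star ((TensorPow.basis H k).repr v b) := by
  rw [LinearMap.toMatrix_apply, ketbra_apply, ← TensorPow.orthonormalBasis_toBasis]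
  simp [OrthonormalBasis.repr_apply_apply, mul_comm]

theorem partialTrace_ketbra_tprod (k : ℕ) {ψ : H} (hψ : ‖ψ‖ = 1) :
    partialTrace H k (ketbra (TensorPow.tprod fun _ => ψ)) = ketbra ψ := by
  apply (LinearMap.toMatrix (stdOrthonormalBasis ℂ H).toBasis
    (stdOrthonormalBasis ℂ H).toBasis).injective
  ext i l
  have h1 : ∑ i, (stdOrthonormalBasis ℂ H).toBasis.repr ψ i *
      star ((stdOrthonormalBasis ℂ H).toBasis.repr ψ i) = 1 := by
    have := (stdOrthonormalBasis ℂ H).sum_inner_mul_inner ψ ψ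
    rw [inner_self_eq_norm_sq_to_K, hψ] at this
    simpa [OrthonormalBasis.repr_apply_apply, mul_comm] using this
  rw [toMatrix_partialTrace, toMatrix_ketbra]
  simp only [toMatrix_ketbra_tensorPow, repr_tprod, Fin.prod_univ_castSucc, Fin.snoc_castSucc,
    Fin.snoc_last, star_mul']
  have h2 := Fintype.sum_pow (fun i => (stdOrthonormalBasis ℂ H).toBasis.repr ψ i *
      star ((stdOrthonormalBasis ℂ H).toBasis.repr ψ i)) k
  rw [h1, one_pow] at h2
  simp only [star_prod]
  -- The `k` traced factors contribute the `k`-th power of the squared norm of `ψ`, which is `1`.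
  rw [Finset.sum_congr rfl fun c _ => mul_mul_mul_comm _ _ _ _, ← Finset.sum_mul]
  simp only [← Finset.prod_mul_distrib]
  rw [← h2, one_mul]

end Basis

/-! ### The implications between arability and tensions -/

section Main

open scoped ComplexOrder Matrix

theorem norm_eq_one_of_inner_self {J : Type*} [NormedAddCommGroup J] [InnerProductSpace ℂ J]
    {v : J} (h : inner ℂ v v = (1 : ℂ)) : ‖v‖ = 1 := by
  rw [norm_eq_sqrt_re_inner (𝕜 := ℂ), h]
  simp

theorem isDensity_ketbra {J : Type*} [NormedAddCommGroup J] [InnerProductSpace ℂ J]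
    [FiniteDimensional ℂ J] {ψ : J} (hψ : ‖ψ‖ = 1) : IsDensity (ketbra ψ) := by
  refine ⟨(InnerProductSpace.isPositive_rankOne_self (𝕜 := ℂ) ψ).toLinearMap, ?_⟩
  rw [ketbra, InnerProductSpace.trace_rankOne, inner_self_eq_norm_sq_to_K, hψ]
  simp

variable [FiniteDimensional ℂ H]

theorem IsTension.mono {k : ℕ} {W W' : Submodule ℂ (TensorPow H (k + 1))} (h : W ≤ W')
    {ρ : H →ₗ[ℂ] H} {σ : TensorPow H (k + 1) →ₗ[ℂ] TensorPow H (k + 1)} (hσ : IsTension W ρ σ) :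
    IsTension W' ρ σ :=
  ⟨hσ.1, hσ.2.1.trans h, hσ.2.2⟩

instance (k : ℕ) : FiniteDimensional ℂ (TensorPow H k) :=
  (TensorPow.basis H k).finiteDimensional_of_finite

theorem convex_setOf_isTension {k : ℕ} (W : Submodule ℂ (TensorPow H (k + 1))) :
    Convex ℝ {ρ : H →ₗ[ℂ] H | ∃ σ, IsTension W ρ σ} := by
  rintro ρ ⟨σ, ⟨hpos, htr⟩, hW, hρ⟩ ρ' ⟨σ', ⟨hpos', htr'⟩, hW', hρ'⟩ p q hp hq hpq
  refine ⟨(p : ℂ) • σ + (q : ℂ) • σ', ⟨?_, ?_⟩, ?_, ?_⟩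
  · exact (hpos.smul_of_nonneg (by exact_mod_cast hp)).add
      (hpos'.smul_of_nonneg (by exact_mod_cast hq))
  · rw [map_add, map_smul, map_smul, htr, htr']
    simp only [smul_eq_mul, mul_one]
    exact_mod_cast hpq
  · rintro - ⟨v, rfl⟩
    exact W.add_mem (W.smul_mem _ (hW ⟨v, rfl⟩)) (W.smul_mem _ (hW' ⟨v, rfl⟩))
  · rw [map_add, map_smul, map_smul, hρ, hρ', Complex.coe_smul, Complex.coe_smul]

theorem IsArable.exists_isTension {X : Set (H →ₗ[ℂ] H)}
    (hX : ∀ P ∈ X, ∃ ψ : H, ‖ψ‖ = 1 ∧ P = ketbra ψ) {ρ : H →ₗ[ℂ] H} (hρ : IsArable X ρ) (k : ℕ) :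
    ∃ σ : TensorPow H (k + 1) →ₗ[ℂ] TensorPow H (k + 1), IsTension (powerSpan X (k + 1)) ρ σ := by
  refine convexHull_min (fun P hP => ?_) (convex_setOf_isTension (powerSpan X (k + 1))) hρ
  obtain ⟨ψ, hψ, rfl⟩ := hX P hP
  have hψ' : ‖(TensorPow.tprod fun _ => ψ : TensorPow H (k + 1))‖ = 1 := by
    have h : inner ℂ (TensorPow.tprod fun _ => ψ : TensorPow H (k + 1))
        (TensorPow.tprod fun _ => ψ) = 1 := by
      rw [TensorPow.inner_tprod, inner_self_eq_norm_sq_to_K, hψ]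
      simp
    exact norm_eq_one_of_inner_self h
  refine ⟨ketbra (TensorPow.tprod fun _ => ψ), isDensity_ketbra hψ', ?_,
    partialTrace_ketbra_tprod k hψ⟩
  rintro - ⟨v, rfl⟩
  exact Submodule.smul_mem _ _ (Submodule.subset_span ⟨ψ, hP, rfl⟩)

/-- Homogeneity of `I` enters here: `zeroSphere` tests only homogeneous elements of `I`, and these
include a generating set, so the whole ideal lies in the kernel of evaluation. -/
theorem toLin_vecMulVec_mem_variety {I : Ideal (PolyRing H)} (hI : IsHomogeneousIdeal I)
    {ψ : Fin (Module.finrank ℂ H) → ℂ} (hψ : ψ ∈ zeroSphere (coordIdeal I)) :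
    Matrix.toLin (stdOrthonormalBasis ℂ H).toBasis (stdOrthonormalBasis ℂ H).toBasis
      (Matrix.vecMulVec ψ (star ψ)) ∈ variety I := by
  obtain ⟨h1, h0⟩ := hψ
  let φ : H := (stdOrthonormalBasis ℂ H).toBasis.equivFun.symm ψ
  have hφ (i) : (stdOrthonormalBasis ℂ H).toBasis.repr φ i = ψ i :=
    congrFun ((stdOrthonormalBasis ℂ H).toBasis.equivFun.apply_symm_apply ψ) i
  refine ⟨φ, ?_, ?_, ?_⟩
  · have := (stdOrthonormalBasis ℂ H).sum_inner_mul_inner φ φ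
    have h2 : inner ℂ φ φ = (1 : ℂ) := by
      rw [← this, ← h1]
      refine Finset.sum_congr rfl fun i _ => ?_
      rw [← hφ, ← inner_conj_symm φ, mul_comm]
      simp [OrthonormalBasis.repr_apply_apply]
    exact norm_eq_one_of_inner_self h2
  · obtain ⟨S, hS, rfl⟩ := hI
    have hle : Ideal.span S ≤ RingHom.ker (evalAt φ) := by
      refine Ideal.span_le.mpr fun s hs => ?_
      obtain ⟨d, f, rfl⟩ := hS s hs
      obtain ⟨u, rfl⟩ := exists_coordTensor_eq f
      rw [tensorToPoly_coordTensor] at hs ⊢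
      change evalAt φ _ = 0
      rw [evalAt_sum_coordVar]
      simp only [hφ]
      exact h0 d u (Ideal.subset_span hs)
    exact fun f hf => hle hf
  · rw [← LinearEquiv.eq_symm_apply, Matrix.toLin_symm]
    ext i l
    rw [toMatrix_ketbra, hφ, hφ]
    rfl

theorem isArable_of_isTension_perp {I : Ideal (PolyRing H)} (hI : IsHomogeneousIdeal I)
    {ρ : H →ₗ[ℂ] H} (h : ∀ k : ℕ, ∃ σ, IsTension (perp I (k + 1)) ρ σ) :
    IsArable (variety I) ρ := by
  let e := (stdOrthonormalBasis ℂ H).toBasis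
  have hR : LinearMap.toMatrix e e ρ ∈ convexHull ℝ (zeroProjections (coordIdeal I)) := by
    refine mem_convexHull_zeroProjections (isSymmetricIdealFamily_coordIdeal I) fun k => ?_
    obtain ⟨σ, ⟨hpos, htr⟩, hW, hρ⟩ := h k
    refine ⟨LinearMap.toMatrix (TensorPow.basis H (k + 1)) (TensorPow.basis H (k + 1)) σ,
      ?_, ?_, fun u hu b => ?_, fun i l => ?_⟩
    · rw [← TensorPow.orthonormalBasis_toBasis]
      exact (LinearMap.posSemidef_toMatrix_iff _).mpr hpos
    · rw [← htr, LinearMap.trace_eq_matrix_trace ℂ (TensorPow.basis H (k + 1))]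
    · simp only [LinearMap.toMatrix_apply]
      -- Each column of the matrix holds the coordinates of a vector in the range of `σ`, hence of
      -- an element of `I_{k+1}^⊥`. Such a vector also pairs to zero with the nonsymmetric tensors
      -- representing elements of `I`.
      rw [← dualDistrib_coordTensor]
      exact dualDistrib_eq_zero_of_mem_perp (hW ⟨_, rfl⟩)
        (by rw [tensorToPoly_coordTensor]; exact hu)
    · rw [← toMatrix_partialTrace, hρ]
  let f : Matrix _ _ ℂ →ₗ[ℝ] (H →ₗ[ℂ] H) := (Matrix.toLin e e).toLinearMap.restrictScalars ℝ
  have hf : f (LinearMap.toMatrix e e ρ) = ρ := Matrix.toLin_toMatrix e e ρ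
  have hmem := Set.mem_image_of_mem f hR
  rw [f.image_convexHull, hf] at hmem
  refine convexHull_mono ?_ hmem
  rintro - ⟨-, ⟨ψ, hψ, rfl⟩, rfl⟩
  exact toLin_vecMulVec_mem_variety hI hψ

end Main

end XTension

end

theorem mainTheorem1 {H : Type*} [NormedAddCommGroup H] [InnerProductSpace ℂ H]
    [FiniteDimensional ℂ H] (I : Ideal (XTension.PolyRing H)) (hI : XTension.IsHomogeneousIdeal I)
    (ρ : H →ₗ[ℂ] H) (hρ : XTension.IsDensity ρ) :
    (XTension.IsArable (XTension.variety I) ρ ↔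
      ∀ k : ℕ, ∃ σ : XTension.TensorPow H (k + 1) →ₗ[ℂ] XTension.TensorPow H (k + 1),
        XTension.IsTension (XTension.perp I (k + 1)) ρ σ) ∧
    (XTension.IsArable (XTension.variety I) ρ ↔
      ∀ k : ℕ, ∃ σ : XTension.TensorPow H (k + 1) →ₗ[ℂ] XTension.TensorPow H (k + 1),
        XTension.IsTension (XTension.powerSpan (XTension.variety I) (k + 1)) ρ σ) := by
  have h13 (h : XTension.IsArable (XTension.variety I) ρ) (k : ℕ) :=
    h.exists_isTension (by rintro P ⟨ψ, hψ, -, hP⟩; exact ⟨ψ, hψ, hP⟩) k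
  have h32 {k : ℕ} {σ : XTension.TensorPow H (k + 1) →ₗ[ℂ] XTension.TensorPow H (k + 1)}
      (h : XTension.IsTension (XTension.powerSpan (XTension.variety I) (k + 1)) ρ σ) :=
    h.mono (XTension.powerSpan_le_perp I (k + 1))
  exact ⟨⟨fun h k => (h13 h k).imp fun _ => h32, XTension.isArable_of_isTension_perp hI⟩,
    h13, fun h => XTension.isArable_of_isTension_perp hI fun k => (h k).imp fun _ => h32⟩
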